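/- Let $M$ be an oriented smooth manifold of dimension $n\ge 1$ (Hausdorff and second countable), let $\mathbb{T}^m=\mathbb{R}^m/2\pi\mathbb{Z}^m$, and let $\omega_1,\dots,\omega_m$ be smooth real-valued closed $1$-forms on $M$. For $0\le q\le n$ let $\mathsf{\Lambda}^{0,q}C^\infty(M\times\mathbb{T}^m)$ be the space of smooth complex-valued forms which are locally $\sum_{|J|=q}f_J(t,x)\,\mathrm{d}t_J$, where $t$ are local coordinates on $M$ and $x\in\mathbb{T}^m$. Fix a countable atlas of positively oriented charts of $M$. The topology of $\mathsf{\Lambda}^{0,q}C^\infty(M\times\mathbb{T}^m)$ is defined by the standard seminorms $$\|f\|_{k,\mathcal{L}}=\sum_{L\in\mathcal{L}}\ \sup_{i\le k}\ \sup_{L\times\mathbb{T}^m}|D^i f|,$$ where $k\in\mathbb{N}_0$, $\mathcal{L}$ is a finite family of compact sets $L$, each given with a chart of the atlas whose domain contains it, and $D^i f$ is the $i$-th derivative in $(t,x)$ of the components of $f$ in that chart. Let $\mathsf{\Lambda}^{0,n-q}\mathcal{E}'(M\times\mathbb{T}^m)$ be the topological dual of $\mathsf{\Lambda}^{0,q}C^\infty(M\times\mathbb{T}^m)$.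 A form $f\in\mathsf{\Lambda}^{0,n}C^\infty(M\times\mathbb{T}^m)$ with compact support is identified with the functional $\phi\mapsto\langle f,\phi\rangle=\int_{M\times\mathbb{T}^m}\phi\,f\wedge\mathrm{d}x$ on $C^\infty(M\times\mathbb{T}^m)$, where $\mathrm{d}x=\mathrm{d}x_1\wedge\dots\wedge\mathrm{d}x_m$. Let $$\mathbb{L}^0:C^\infty(M\times\mathbb{T}^m)\to\mathsf{\Lambda}^{0,1}C^\infty(M\times\mathbb{T}^m),\qquad \mathbb{L}^0\phi=\mathrm{d}_t\phi+\sum_{k=1}^m\omega_k\wedge\partial_{x_k}\phi,$$ where $\mathrm{d}_t$ is the exterior derivative in the variable of $M$, and let $\mathbb{L}^{n-1}:\mathsf{\Lambda}^{0,n-1}\mathcal{E}'(M\times\mathbb{T}^m)\to\mathsf{\Lambda}^{0,n}\mathcal{E}'(M\times\mathbb{T}^m)$ be the transpose of $(-1)^n\mathbb{L}^0$, that is, $\langle\mathbb{L}^{n-1}u,\phi\rangle=(-1)^n\langle u,\mathbb{L}^0\phi\rangle$ for all $\phi\in C^\infty(M\times\mathbb{T}^m)$. A form $f\in\mathsf{\Lambda}^{0,n}C_c^\infty(M\times\mathbb{T}^m)$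 is called compatible if $$\langle f,\phi\rangle=0\quad\text{for all }\phi\in C^\infty(M\times\mathbb{T}^m)\text{ with }\mathbb{L}^0\phi=0.$$ The operator $\mathbb{L}^{n-1}$ is called globally $(\mathcal{E}',C_c^\infty)$-solvable if for every compatible $f\in\mathsf{\Lambda}^{0,n}C_c^\infty(M\times\mathbb{T}^m)$ there is $u\in\mathsf{\Lambda}^{0,n-1}\mathcal{E}'(M\times\mathbb{T}^m)$ with $\mathbb{L}^{n-1}u=f$. **Proposition.** Suppose that $\mathbb{L}^{n-1}$ is globally $(\mathcal{E}',C_c^\infty)$-solvable. Then for every compact set $K\subset M$ there exist $C>0$ and standard seminorms $\|\cdot\|_{k,\mathcal{L}}$ on $\mathsf{\Lambda}^{0,n}C^\infty(M\times\mathbb{T}^m)$ and $\|\cdot\|_{\ell,\mathcal{L}'}$ on $\mathsf{\Lambda}^{0,1}C^\infty(M\times\mathbb{T}^m)$, depending on $K$, such that $$\left|\int_{M\times\mathbb{T}^m}\phi(t,x)\,f(t,x)\wedge\mathrm{d}x\right|\le C\,\|f\|_{k,\mathcal{L}}\,\|\mathbb{L}^0\phi\|_{\ell,\mathcal{L}'}$$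 for all compatible $f\in\mathsf{\Lambda}^{0,n}C^\infty(M\times\mathbb{T}^m)$ with support in $K\times\mathbb{T}^m$ and all $\phi\in C^\infty(M\times\mathbb{T}^m)$. -/

import Mathlib

namespace InvolutiveSystem

noncomputable section

open scoped Manifold ContDiff Topology
open Set MeasureTheory

instance factTwoPiPos : Fact (0 < 2 * Real.pi) := ⟨Real.two_pi_pos⟩

/-- The coordinate space `ℝⁿ`. -/
abbrev Euc (n : ℕ) : Type := EuclideanSpace ℝ (Fin n)

/-- The torus `𝕋ᵐ = ℝᵐ / 2πℤᵐ`. Its `volume` is Lebesgue measure `dx`, of total mass `(2π)ᵐ`. -/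
abbrev Torus (m : ℕ) : Type := Fin m → AddCircle (2 * Real.pi)

/-- The covering map `ℝᵐ → 𝕋ᵐ`. The smooth structure of `𝕋ᵐ` is the one for which it is a local
diffeomorphism, so smoothness on `M × 𝕋ᵐ` is smoothness of the lift to `M × ℝᵐ`. -/
def torusMk {m : ℕ} (x : Fin m → ℝ) : Torus m := fun k => (x k : AddCircle (2 * Real.pi))

theorem torusMk_surjective {m : ℕ} : Function.Surjective (torusMk (m := m)) := by
  intro x
  choose y hy using fun k => QuotientAddGroup.mk_surjective (x k)
  exact ⟨y, funext hy⟩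

theorem torusMk_add {m : ℕ} (x y : Fin m → ℝ) : torusMk (x + y) = torusMk x + torusMk y := by
  funext k
  simp [torusMk]

/-- The box `[0, 2π]ᵐ`, which the covering map sends onto `𝕋ᵐ`. -/
def torusBox (m : ℕ) : Set (Fin m → ℝ) := Set.Icc 0 (fun _ => 2 * Real.pi)

section Manifold

variable (n : ℕ) (M : Type*) [TopologicalSpace M] [ChartedSpace (Euc n) M]

/-- A countable oriented smooth atlas: countably many charts of the smooth structure of `M`, which
cover `M` and whose transition maps have positive Jacobian determinant. -/
structure OrientedAtlas where
  chart : ℕ → OpenPartialHomeomorph M (Euc n)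
  mem_maximalAtlas : ∀ j, chart j ∈ IsManifold.maximalAtlas (𝓡 n) ∞ M
  cover : ∀ t : M, ∃ j, t ∈ (chart j).source
  oriented : ∀ i j, ∀ y ∈ ((chart i).symm.trans (chart j)).source,
    0 < (fderiv ℝ ((chart i).symm.trans (chart j)) y).det

/-- Smooth functions `M × 𝕋ᵐ → ℂ`. -/
structure SmoothFun (m : ℕ) where
  toFun : M × Torus m → ℂ
  smooth : ContMDiff ((𝓡 n).prod 𝓘(ℝ, Fin m → ℝ)) 𝓘(ℝ, ℂ) ∞
    (fun p : M × (Fin m → ℝ) => toFun (p.1, torusMk p.2))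

end Manifold

variable {n : ℕ} {M : Type*} [TopologicalSpace M] [ChartedSpace (Euc n) M]

/-- The expression in the chart `e` of a field `α` of alternating `q`-forms on the tangent spaces
of `M`: the pullback of `α` under `e⁻¹`. -/
def coordForm {q : ℕ} {F : Type*} [NormedAddCommGroup F] [NormedSpace ℝ F]
    (e : OpenPartialHomeomorph M (Euc n))
    (α : ∀ t : M, (TangentSpace (𝓡 n) t) [⋀^Fin q]→L[ℝ] F) (y : Euc n) :
    (Euc n) [⋀^Fin q]→L[ℝ] F :=
  (α (e.symm y)).compContinuousLinearMap (mfderiv (𝓡 n) (𝓡 n) e.symm y)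

/-- A smooth real-valued closed `1`-form on `M`. -/
structure ClosedOneForm (𝔄 : OrientedAtlas n M) where
  toFun : ∀ t : M, (TangentSpace (𝓡 n) t) [⋀^Fin 1]→L[ℝ] ℝ
  smooth : ∀ j, ContDiffOn ℝ ∞ (coordForm (𝔄.chart j) toFun) (𝔄.chart j).target
  closed : ∀ j, ∀ y ∈ (𝔄.chart j).target, extDeriv (coordForm (𝔄.chart j) toFun) y = 0

/-- Not necessarily smooth `(0,q)`-forms on `M × 𝕋ᵐ`: at a point `(t, x)` such a form is an
alternating `q`-form on `T_t M`, with complex values. -/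
abbrev RawForm (n : ℕ) (M : Type*) [TopologicalSpace M] [ChartedSpace (Euc n) M] (m q : ℕ) :
    Type _ :=
  ∀ p : M × Torus m, (TangentSpace (𝓡 n) p.1) [⋀^Fin q]→L[ℝ] ℂ

/-- The expression of a `(0,q)`-form in the chart `e × (covering map)`, a function on
`e.target × ℝᵐ`. -/
def liftCoord {m q : ℕ} (e : OpenPartialHomeomorph M (Euc n)) (f : RawForm n M m q) :
    Euc n × (Fin m → ℝ) → (Euc n) [⋀^Fin q]→L[ℝ] ℂ :=
  fun z => coordForm e (fun t => f (t, torusMk z.2)) z.1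

theorem liftCoord_add {m q : ℕ} (e : OpenPartialHomeomorph M (Euc n)) (f g : RawForm n M m q) :
    liftCoord e (f + g) = liftCoord e f + liftCoord e g := rfl

theorem liftCoord_smul {m q : ℕ} (e : OpenPartialHomeomorph M (Euc n)) (c : ℂ)
    (f : RawForm n M m q) : liftCoord e (c • f) = c • liftCoord e f := rfl

/-- The space `Λ^{0,q} C^∞(M × 𝕋ᵐ)`, as a space of fields of alternating forms. -/
def smoothFormSubmodule (𝔄 : OrientedAtlas n M) (m q : ℕ) : Submodule ℂ (RawForm n M m q) where
  carrier := {f | ∀ j, ContDiffOn ℝ ∞ (liftCoord (𝔄.chart j) f) ((𝔄.chart j).target ×ˢ univ)}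
  add_mem' := by
    intro f g hf hg j
    rw [liftCoord_add]
    exact (hf j).add (hg j)
  zero_mem' := fun j => contDiffOn_const (c := (0 : (Euc n) [⋀^Fin q]→L[ℝ] ℂ))
  smul_mem' := by
    intro c f hf j
    rw [liftCoord_smul]
    exact contDiffOn_const.smul (hf j)

/-- The space `Λ^{0,q} C^∞(M × 𝕋ᵐ)` of smooth `(0,q)`-forms. -/
def SmoothForm (𝔄 : OrientedAtlas n M) (m q : ℕ) : Type _ := smoothFormSubmodule 𝔄 m q

namespace SmoothForm

variable {𝔄 : OrientedAtlas n M} {m q : ℕ}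

instance : AddCommGroup (SmoothForm 𝔄 m q) :=
  inferInstanceAs (AddCommGroup (smoothFormSubmodule 𝔄 m q))

instance : Module ℂ (SmoothForm 𝔄 m q) :=
  inferInstanceAs (Module ℂ (smoothFormSubmodule 𝔄 m q))

/-- The underlying field of alternating forms. -/
def val (f : SmoothForm 𝔄 m q) : RawForm n M m q := Subtype.val f

theorem val_add (f g : SmoothForm 𝔄 m q) : (f + g).val = f.val + g.val := rfl

theorem val_smul (c : ℂ) (f : SmoothForm 𝔄 m q) : (c • f).val = c • f.val := rfl

theorem smooth (f : SmoothForm 𝔄 m q) (j : ℕ) :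
    ContDiffOn ℝ ∞ (liftCoord (𝔄.chart j) f.val) ((𝔄.chart j).target ×ˢ univ) :=
  Subtype.property f j

end SmoothForm

/-- A chart of the atlas together with a compact subset of its domain. -/
structure ChartCompact (𝔄 : OrientedAtlas n M) where
  idx : ℕ
  carrier : Set M
  isCompact : IsCompact carrier
  subset : carrier ⊆ (𝔄.chart idx).source

/-- The compact set `χ(L) × [0, 2π]ᵐ` in coordinates. -/
def ChartCompact.coordSet {𝔄 : OrientedAtlas n M} (P : ChartCompact 𝔄) (m : ℕ) :
    Set (Euc n × (Fin m → ℝ)) :=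
  ((𝔄.chart P.idx) '' P.carrier) ×ˢ torusBox m

theorem ChartCompact.coordSet_isCompact {𝔄 : OrientedAtlas n M} (P : ChartCompact 𝔄) (m : ℕ) :
    IsCompact (P.coordSet m) :=
  (P.isCompact.image_of_continuousOn
    ((𝔄.chart P.idx).continuousOn.mono P.subset)).prod isCompact_Icc

theorem ChartCompact.coordSet_subset {𝔄 : OrientedAtlas n M} (P : ChartCompact 𝔄) (m : ℕ) :
    P.coordSet m ⊆ (𝔄.chart P.idx).target ×ˢ univ := by
  rintro ⟨y, x⟩ ⟨⟨t, ht, rfl⟩, -⟩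
  exact ⟨(𝔄.chart P.idx).map_source (P.subset ht), mem_univ _⟩

theorem SmoothForm.contDiffAt {𝔄 : OrientedAtlas n M} {m q : ℕ} (f : SmoothForm 𝔄 m q)
    (P : ChartCompact 𝔄) {z : Euc n × (Fin m → ℝ)} (hz : z ∈ P.coordSet m) :
    ContDiffAt ℝ ∞ (liftCoord (𝔄.chart P.idx) f.val) z :=
  (f.smooth P.idx).contDiffAt
    (((𝔄.chart P.idx).open_target.prod isOpen_univ).mem_nhds (P.coordSet_subset m hz))

theorem bddAbove_iteratedFDeriv {𝔄 : OrientedAtlas n M} {m q : ℕ} (f : SmoothForm 𝔄 m q)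
    (P : ChartCompact 𝔄) (i : ℕ) :
    BddAbove (range fun z : P.coordSet m =>
      ‖iteratedFDeriv ℝ i (liftCoord (𝔄.chart P.idx) f.val) z‖) := by
  have hc : ContinuousOn
      (fun z => ‖iteratedFDeriv ℝ i (liftCoord (𝔄.chart P.idx) f.val) z‖) (P.coordSet m) := by
    intro z hz
    have h := (f.contDiffAt P hz).iteratedFDeriv_right (m := 0) (i := i) (by
      exact_mod_cast le_top)
    exact h.continuousAt.norm.continuousWithinAt
  have := (P.coordSet_isCompact m).bddAbove_image hc
  rwa [image_eq_range] at this

/-- `f ↦ sup |D^i f|` over `L × 𝕋ᵐ`, in the coordinates of one chart. -/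
def derivSeminorm {𝔄 : OrientedAtlas n M} (m q : ℕ) (P : ChartCompact 𝔄) (i : ℕ) :
    Seminorm ℂ (SmoothForm 𝔄 m q) :=
  Seminorm.of
    (fun f => ⨆ z : P.coordSet m, ‖iteratedFDeriv ℝ i (liftCoord (𝔄.chart P.idx) f.val) z‖)
    (by
      intro f g
      refine Real.iSup_le (fun z => ?_) (add_nonneg (Real.iSup_nonneg fun _ => norm_nonneg _)
        (Real.iSup_nonneg fun _ => norm_nonneg _))
      have hi : (i : WithTop ℕ∞) ≤ ∞ := by exact_mod_cast le_top
      rw [SmoothForm.val_add, liftCoord_add,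
        iteratedFDeriv_add_apply ((f.contDiffAt P z.2).of_le hi) ((g.contDiffAt P z.2).of_le hi)]
      exact (norm_add_le _ _).trans (add_le_add (le_ciSup (bddAbove_iteratedFDeriv f P i) z)
        (le_ciSup (bddAbove_iteratedFDeriv g P i) z)))
    (by
      intro c f
      have hi : (i : WithTop ℕ∞) ≤ ∞ := by exact_mod_cast le_top
      rw [Real.mul_iSup_of_nonneg (norm_nonneg c)]
      refine iSup_congr fun z => ?_
      rw [SmoothForm.val_smul, liftCoord_smul,
        iteratedFDeriv_const_smul_apply ((f.contDiffAt P z.2).of_le hi), norm_smul])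

/-- The standard seminorms `‖f‖_{k,𝓛} = ∑_{L ∈ 𝓛} sup_{i ≤ k} sup_{L × 𝕋ᵐ} |D^i f|` of
`Λ^{0,q} C^∞(M × 𝕋ᵐ)`, indexed by a finite family `𝓛` of compact sets, each of them contained in
the domain of a chart, and by an order `k`. -/
def formSeminorm (𝔄 : OrientedAtlas n M) (m q : ℕ) :
    SeminormFamily ℂ (SmoothForm 𝔄 m q) (Finset (ChartCompact 𝔄) × ℕ) :=
  fun s => ∑ P ∈ s.1, (Finset.range (s.2 + 1)).sup (fun i => derivSeminorm m q P i)

/-- The Fréchet topology of `Λ^{0,q} C^∞(M × 𝕋ᵐ)`. -/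
instance (𝔄 : OrientedAtlas n M) (m q : ℕ) : TopologicalSpace (SmoothForm 𝔄 m q) :=
  (formSeminorm 𝔄 m q).moduleFilterBasis.topology

theorem withSeminorms_formSeminorm (𝔄 : OrientedAtlas n M) (m q : ℕ) :
    WithSeminorms (formSeminorm 𝔄 m q) := ⟨rfl⟩

/-- `Λ^{0,n-q} 𝓔'(M × 𝕋ᵐ)`, the compactly supported currents: the topological dual of
`Λ^{0,q} C^∞(M × 𝕋ᵐ)`. -/
abbrev CompactCurrent (𝔄 : OrientedAtlas n M) (m q : ℕ) : Type _ := SmoothForm 𝔄 m q →L[ℂ] ℂ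

/-- `∂_{x_k} φ`. -/
def torusDeriv {m : ℕ} (φ : SmoothFun n M m) (k : Fin m) (p : M × Torus m) : ℂ :=
  deriv (fun s : ℝ => φ.toFun (p.1, p.2 + torusMk (Pi.single k s))) 0

/-- `d_t φ`, the differential of `φ` in the variable of `M`. -/
def partialD {m : ℕ} (φ : SmoothFun n M m) : RawForm n M m 1 :=
  fun p => ContinuousAlternatingMap.ofSubsingleton ℝ (TangentSpace (𝓡 n) p.1) ℂ (0 : Fin 1)
    (mfderiv (𝓡 n) 𝓘(ℝ, ℂ) (fun t => φ.toFun (t, p.2)) p.1)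

/-- `d_t φ + ∑ₖ wₖ ∧ ∂_{x_k} φ`. -/
def rawL0 {𝔄 : OrientedAtlas n M} {m : ℕ} (w : Fin m → ClosedOneForm 𝔄) (φ : SmoothFun n M m) :
    RawForm n M m 1 :=
  fun p => partialD φ p +
    ∑ k, torusDeriv φ k p • Complex.ofRealCLM.compContinuousAlternatingMap ((w k).toFun p.1)

/-- The function `φ` in the coordinates of a chart, lifted to `ℝᵐ`. -/
def coordFun {m : ℕ} (e : OpenPartialHomeomorph M (Euc n)) (φ : SmoothFun n M m) :
    Euc n × (Fin m → ℝ) → ℂ :=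
  fun z => φ.toFun (e.symm z.1, torusMk z.2)

theorem contDiffOn_coordFun (𝔄 : OrientedAtlas n M) {m : ℕ} (φ : SmoothFun n M m) (j : ℕ) :
    ContDiffOn ℝ ∞ (coordFun (𝔄.chart j) φ) ((𝔄.chart j).target ×ˢ univ) := by
  rw [← contMDiffOn_iff_contDiffOn]
  have h1 : ContMDiffOn (𝓡 n) (𝓡 n) ∞ (𝔄.chart j).symm (𝔄.chart j).target :=
    contMDiffOn_symm_of_mem_maximalAtlas (𝔄.mem_maximalAtlas j)
  have h2 : ContMDiffOn ((𝓡 n).prod 𝓘(ℝ, Fin m → ℝ)) ((𝓡 n).prod 𝓘(ℝ, Fin m → ℝ)) ∞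
      (Prod.map (𝔄.chart j).symm (id : (Fin m → ℝ) → (Fin m → ℝ)))
      ((𝔄.chart j).target ×ˢ univ) := h1.prodMap contMDiffOn_id
  have h3 := φ.smooth.comp_contMDiffOn h2
  rw [modelWithCornersSelf_prod, ← chartedSpaceSelf_prod]
  exact h3

theorem differentiableAt_coordFun (𝔄 : OrientedAtlas n M) {m : ℕ} (φ : SmoothFun n M m) (j : ℕ)
    {z : Euc n × (Fin m → ℝ)} (hz : z ∈ (𝔄.chart j).target ×ˢ (univ : Set (Fin m → ℝ))) :
    DifferentiableAt ℝ (coordFun (𝔄.chart j) φ) z :=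
  ((contDiffOn_coordFun 𝔄 φ j).contDiffAt
    (((𝔄.chart j).open_target.prod isOpen_univ).mem_nhds hz)).differentiableAt (by simp)

theorem liftCoord_partialD (𝔄 : OrientedAtlas n M) {m : ℕ} (φ : SmoothFun n M m) (j : ℕ)
    {z : Euc n × (Fin m → ℝ)} (hz : z ∈ (𝔄.chart j).target ×ˢ (univ : Set (Fin m → ℝ))) :
    liftCoord (𝔄.chart j) (partialD φ) z =
      ContinuousAlternatingMap.ofSubsingleton ℝ (Euc n) ℂ (0 : Fin 1)
        ((fderiv ℝ (coordFun (𝔄.chart j) φ) z).comp (ContinuousLinearMap.inl ℝ _ _)) := by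
  obtain ⟨y, x⟩ := z
  have hy : y ∈ (𝔄.chart j).target := hz.1
  have h1 : MDifferentiableAt (𝓡 n) (𝓡 n) (𝔄.chart j).symm y :=
    ((contMDiffOn_symm_of_mem_maximalAtlas (𝔄.mem_maximalAtlas j)).contMDiffAt
      ((𝔄.chart j).open_target.mem_nhds hy)).mdifferentiableAt (by simp)
  have h2 : MDifferentiableAt (𝓡 n) 𝓘(ℝ, ℂ) (fun t => φ.toFun (t, torusMk x))
      ((𝔄.chart j).symm y) := by
    have h3 : ContMDiff (𝓡 n) ((𝓡 n).prod 𝓘(ℝ, Fin m → ℝ)) ∞ (fun t : M => (t, x)) :=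
      contMDiff_id.prodMk contMDiff_const
    exact (φ.smooth.comp h3).contMDiffAt.mdifferentiableAt (by simp)
  have h4 := mfderiv_comp y h2 h1
  have h5 : HasFDerivAt (fun y' => coordFun (𝔄.chart j) φ (y', x))
      ((fderiv ℝ (coordFun (𝔄.chart j) φ) (y, x)).comp (ContinuousLinearMap.inl ℝ _ _)) y :=
    HasFDerivAt.comp (g := coordFun (𝔄.chart j) φ) (f := fun y' => (y', x)) y
      (differentiableAt_coordFun 𝔄 φ j hz).hasFDerivAt (hasFDerivAt_prodMk_left y x)
  have h6 : mfderiv (𝓡 n) 𝓘(ℝ, ℂ) ((fun t => φ.toFun (t, torusMk x)) ∘ (𝔄.chart j).symm) y =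
      (fderiv ℝ (coordFun (𝔄.chart j) φ) (y, x)).comp (ContinuousLinearMap.inl ℝ _ _) := by
    rw [mfderiv_eq_fderiv]
    exact h5.fderiv
  rw [← h6, h4]
  rfl

theorem torusDeriv_eq (𝔄 : OrientedAtlas n M) {m : ℕ} (φ : SmoothFun n M m) (j : ℕ) (k : Fin m)
    {z : Euc n × (Fin m → ℝ)} (hz : z ∈ (𝔄.chart j).target ×ˢ (univ : Set (Fin m → ℝ))) :
    torusDeriv φ k ((𝔄.chart j).symm z.1, torusMk z.2) =
      fderiv ℝ (coordFun (𝔄.chart j) φ) z (0, Pi.single k 1) := by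
  have h := (differentiableAt_coordFun 𝔄 φ j hz).lineDeriv_eq_fderiv (v := (0, Pi.single k 1))
  rw [← h, lineDeriv, torusDeriv]
  congr 1
  funext s
  simp only [coordFun, Prod.fst_add, Prod.snd_add, Prod.smul_fst, Prod.smul_snd, smul_zero,
    add_zero, ← torusMk_add]
  congr 4
  rw [← Pi.single_smul]
  simp

theorem rawL0_mem {𝔄 : OrientedAtlas n M} {m : ℕ} (w : Fin m → ClosedOneForm 𝔄)
    (φ : SmoothFun n M m) : rawL0 w φ ∈ smoothFormSubmodule 𝔄 m 1 := by
  intro j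
  have ho : IsOpen ((𝔄.chart j).target ×ˢ (univ : Set (Fin m → ℝ))) :=
    (𝔄.chart j).open_target.prod isOpen_univ
  have hD : ContDiffOn ℝ ∞ (fderiv ℝ (coordFun (𝔄.chart j) φ))
      ((𝔄.chart j).target ×ˢ univ) :=
    (contDiffOn_coordFun 𝔄 φ j).fderiv_of_isOpen ho (by simp)
  have key : ∀ z ∈ (𝔄.chart j).target ×ˢ (univ : Set (Fin m → ℝ)),
      liftCoord (𝔄.chart j) (rawL0 w φ) z =
      ContinuousAlternatingMap.ofSubsingletonLIE (𝕜 := ℝ) (E := Euc n) (F := ℂ) (0 : Fin 1)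
        ((fderiv ℝ (coordFun (𝔄.chart j) φ) z).comp (ContinuousLinearMap.inl ℝ _ _)) +
      ∑ k, fderiv ℝ (coordFun (𝔄.chart j) φ) z (0, Pi.single k 1) •
        ContinuousLinearMap.compContinuousAlternatingMapCLM ℝ (Euc n) ℝ ℂ (Fin 1)
          Complex.ofRealCLM (coordForm (𝔄.chart j) (w k).toFun z.1) := by
    intro z hz
    have h : liftCoord (𝔄.chart j) (rawL0 w φ) z = liftCoord (𝔄.chart j) (partialD φ) z +
        coordForm (𝔄.chart j) (fun t => ∑ k, torusDeriv φ k (t, torusMk z.2) •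
          Complex.ofRealCLM.compContinuousAlternatingMap ((w k).toFun t)) z.1 := rfl
    rw [h, liftCoord_partialD 𝔄 φ j hz]
    congr 1
    ext v
    have hs : ∀ (A : Fin m → (TangentSpace (𝓡 n) ((𝔄.chart j).symm z.1)) [⋀^Fin 1]→L[ℝ] ℂ) v',
        (∑ k, A k) v' = ∑ k, A k v' := fun A v' => ContinuousAlternatingMap.sum_apply _ _
    simp only [coordForm, ContinuousAlternatingMap.sum_apply, ContinuousAlternatingMap.smul_apply,
      torusDeriv_eq 𝔄 φ j _ hz]
    exact hs _ _
  refine ContDiffOn.congr ?_ key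
  refine ContDiffOn.add ?_ (ContDiffOn.sum fun k _ => ContDiffOn.fun_smul ?_ ?_)
  · exact (LinearIsometryEquiv.contDiff _).comp_contDiffOn (hD.clm_comp contDiffOn_const)
  · exact hD.clm_apply contDiffOn_const
  · exact (ContinuousLinearMap.contDiff _).comp_contDiffOn
      (((w k).smooth j).comp contDiffOn_fst fun z hz => hz.1)

/-- The operator `L⁰ : C^∞(M × 𝕋ᵐ) → Λ^{0,1} C^∞(M × 𝕋ᵐ)`. -/
def L0 {𝔄 : OrientedAtlas n M} {m : ℕ} (w : Fin m → ClosedOneForm 𝔄) (φ : SmoothFun n M m) :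
    SmoothForm 𝔄 m 1 :=
  ⟨rawL0 w φ, rawL0_mem w φ⟩

/-- `L^{n-1} u`, as a functional on `C^∞(M × 𝕋ᵐ)`, for a current `u` in `Λ^{0,n-1} 𝓔'(M × 𝕋ᵐ)`:
on currents `L^{n-1}` is the transpose of `(-1)ⁿ L⁰`. -/
def LTop {𝔄 : OrientedAtlas n M} {m : ℕ} (w : Fin m → ClosedOneForm 𝔄)
    (u : CompactCurrent 𝔄 m 1) (φ : SmoothFun n M m) : ℂ :=
  (-1) ^ n * u (L0 w φ)

theorem OrientedAtlas.exists_partition [IsManifold (𝓡 n) ∞ M] [T2Space M] [SecondCountableTopology M]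
    (𝔄 : OrientedAtlas n M) :
    ∃ ρ : SmoothPartitionOfUnity ℕ (𝓡 n) M univ,
      ρ.IsSubordinate (fun j => (𝔄.chart j).source) := by
  have : LocallyCompactSpace M := ChartedSpace.locallyCompactSpace (Euc n) M
  exact SmoothPartitionOfUnity.exists_isSubordinate (𝓡 n) isClosed_univ _
    (fun j => (𝔄.chart j).open_source) (fun t _ => mem_iUnion.2 (𝔄.cover t))

/-- A smooth partition of unity subordinate to the atlas. -/
def OrientedAtlas.partition [IsManifold (𝓡 n) ∞ M] [T2Space M]
    [SecondCountableTopology M] (𝔄 : OrientedAtlas n M) :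
    SmoothPartitionOfUnity ℕ (𝓡 n) M univ :=
  Classical.choose 𝔄.exists_partition

/-- The coefficient `g` of an `(0,n)`-form `g dt₁ ∧ ⋯ ∧ dtₙ` in a chart of `M`. -/
def topCoeff {m : ℕ} (e : OpenPartialHomeomorph M (Euc n)) (f : RawForm n M m n)
    (z : Euc n × Torus m) : ℂ :=
  coordForm e (fun t => f (t, z.2)) z.1 (fun i => EuclideanSpace.single i (1 : ℝ))

/-- `∫_{M × 𝕋ᵐ} f ∧ dx` for a `(0,n)`-form `f` with compact support, through the partition of unity
and the positively oriented charts of the atlas. -/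
def integral [IsManifold (𝓡 n) ∞ M] [T2Space M]
    [SecondCountableTopology M] (𝔄 : OrientedAtlas n M) {m : ℕ}
    (f : RawForm n M m n) : ℂ :=
  ∑ᶠ j : ℕ, ∫ z in (𝔄.chart j).target ×ˢ (univ : Set (Torus m)),
    (𝔄.partition j ((𝔄.chart j).symm z.1) : ℂ) * topCoeff (𝔄.chart j) f z

/-- `∫_{M × 𝕋ᵐ} φ f ∧ dx`. -/
def pairing [IsManifold (𝓡 n) ∞ M] [T2Space M]
    [SecondCountableTopology M] {𝔄 : OrientedAtlas n M} {m : ℕ}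
    (f : SmoothForm 𝔄 m n) (φ : SmoothFun n M m) : ℂ :=
  integral 𝔄 (fun p => φ.toFun p • f.val p)

/-- The support of `f` is contained in `K × 𝕋ᵐ` (for a compact `K`). -/
def SupportedIn {𝔄 : OrientedAtlas n M} {m q : ℕ} (f : SmoothForm 𝔄 m q) (K : Set M) : Prop :=
  ∀ p : M × Torus m, p.1 ∉ K → f.val p = 0

/-- The compatibility condition: `f` is orthogonal to `C^∞(M × 𝕋ᵐ) ∩ ker L⁰`. -/
def Compatible [IsManifold (𝓡 n) ∞ M] [T2Space M]
    [SecondCountableTopology M] {𝔄 : OrientedAtlas n M} {m : ℕ}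
    (w : Fin m → ClosedOneForm 𝔄) (f : SmoothForm 𝔄 m n) : Prop :=
  ∀ φ : SmoothFun n M m, L0 w φ = 0 → pairing f φ = 0

/-- Global `(𝓔', C_c^∞)`-solvability of `L^{n-1}`. -/
def GloballySolvable [IsManifold (𝓡 n) ∞ M] [T2Space M]
    [SecondCountableTopology M] {𝔄 : OrientedAtlas n M} {m : ℕ}
    (w : Fin m → ClosedOneForm 𝔄) : Prop :=
  ∀ f : SmoothForm 𝔄 m n, (∃ K : Set M, IsCompact K ∧ SupportedIn f K) → Compatible w f →
    ∃ u : CompactCurrent 𝔄 m 1, ∀ φ : SmoothFun n M m, LTop w u φ = pairing f φ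

end

end InvolutiveSystem

/-! ### Functional analysis: Fréchet completeness, Banach–Steinhaus, smooth series. -/

section FunctionalAnalysis

open Filter Topology Set

/-! This is the classical passage from separate to joint continuity of a bilinear form, by
Banach–Steinhaus. Let `V` be the space of compatible forms supported in `K × 𝕋ᵐ`, and measure `φ`
only through the gauges `‖L⁰φ‖_N`. For fixed `φ` the pairing is continuous on `V`, because the
integration takes place over finitely many compact pieces (`exists_norm_pairing_le`). For fixed `f`,
solvability gives a current `u` with `⟨f, φ⟩ = ± u(L⁰φ)`, so continuity of `u` bounds the pairing by
one of the gauges.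

If no joint bound held, there would be `φ_N`, `x_N` and weights `c_N ≥ 0` such that `c_N ‖L⁰φ_N‖_N ≤
1` while `|c_N ⟨x_N, φ_N⟩|` exceeds `N` times the `N`-th seminorm of `x_N`. The functionals `c_N ⟨·,
φ_N⟩` are pointwise bounded, hence equicontinuous, which is a contradiction for large `N`
(`Seminorm.exists_bilinear_bound`). No linear structure or completeness is needed on the side of
`φ`.

Banach–Steinhaus requires `V` to be Fréchet. A countable cofinal family of seminorms comes from
exhausting the chart domains by compact sets (`exists_cofinal_formSeminorm`). For completeness,
absolutely convergent series of smooth forms are differentiated term by term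
(`exists_tendsto_of_summable`), and compatibility passes to limits
(`mem_compatibleSubmodule_of_tendsto`). -/

theorem Seminorm.finset_sup_le_of_monotone {V : Type*} [AddCommGroup V] [Module ℂ V]
    {p : ℕ → Seminorm ℂ V} (hp : Monotone p) (s : Finset ℕ) : ∃ N, s.sup p ≤ p N :=
  ⟨s.sup id, Finset.sup_le fun _ hi => hp (Finset.le_sup (f := id) hi)⟩

/-- A space whose topology is given by an increasing sequence of seminorms is complete as soon as
its absolutely convergent series converge. -/
theorem WithSeminorms.completeSpace_of_summable {V : Type*} [AddCommGroup V] [Module ℂ V]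
    [UniformSpace V] [IsUniformAddGroup V] {p : ℕ → Seminorm ℂ V} (hV : WithSeminorms p)
    (hp : Monotone p)
    (hc : ∀ f : ℕ → V, (∀ N, Summable fun i => p N (f i)) →
      ∃ g, ∀ N, Tendsto (fun r => p N (g - ∑ i ∈ Finset.range r, f i)) atTop (𝓝 0)) :
    CompleteSpace V := by
  have : FirstCountableTopology V := hV.firstCountableTopology
  have : (uniformity V).IsCountablyGenerated := IsUniformAddGroup.uniformity_countably_generated
  refine UniformSpace.complete_of_convergent_controlled_sequences
    (fun N => {z : V × V | p N (z.2 - z.1) < (1 / 2) ^ N}) (fun N => ?_) fun u hu => ?_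
  · rw [uniformity_eq_comap_nhds_zero]
    refine ⟨(p N).ball 0 ((1 / 2) ^ N), ?_, fun z hz => ?_⟩
    · exact Seminorm.ball_mem_nhds (hV.continuous_seminorm N) (by positivity)
    · simpa [Seminorm.mem_ball_zero] using hz
  -- The telescoping series converges absolutely: for `i ≥ N` monotonicity gives `p N ≤ p i`, and
  -- the `i`-th increment has `p i` less than `2⁻ⁱ`.
  · obtain ⟨g, hg⟩ := hc (fun i => u (i + 1) - u i) (fun N => by
      refine Summable.of_norm_bounded_eventually_nat (g := fun i : ℕ => (1 / 2 : ℝ) ^ i)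
        summable_geometric_two ?_
      filter_upwards [eventually_ge_atTop N] with i hi
      rw [Real.norm_of_nonneg (apply_nonneg _ _)]
      exact (hp hi _).trans (hu i i (i + 1) le_rfl (Nat.le_succ i)).le)
    refine ⟨g + u 0, (hV.tendsto_nhds _ _).2 fun N ε hε => ?_⟩
    filter_upwards [(hg N).eventually_lt_const hε] with r hr
    rw [Finset.sum_range_sub] at hr
    rwa [map_sub_rev, show g + u 0 - u r = g - (u r - u 0) by abel]

/-- The Banach–Steinhaus theorem, for a sequence of functionals on a space with an increasing
sequence of seminorms whose absolutely convergent series converge. -/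
theorem Seminorm.exists_uniform_bound {V : Type*} [AddCommGroup V] [Module ℂ V]
    {p : ℕ → Seminorm ℂ V} (hp : Monotone p)
    (hc : ∀ f : ℕ → V, (∀ N, Summable fun i => p N (f i)) →
      ∃ g, ∀ N, Tendsto (fun r => p N (g - ∑ i ∈ Finset.range r, f i)) atTop (𝓝 0))
    {ι : Type*} [Nonempty ι] (T : ι → V →ₗ[ℂ] ℂ) (hT : ∀ i, ∃ C N, ∀ x, ‖T i x‖ ≤ C * p N x)
    (hb : ∀ x, BddAbove (range fun i => ‖T i x‖)) :
    ∃ C N, 0 ≤ C ∧ ∀ i x, ‖T i x‖ ≤ C * p N x := by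
  -- The statement puts no topology on `V`. With the one generated by `p`, the space is complete
  -- with countably generated uniformity, hence Baire and therefore barrelled, so a pointwise
  -- bounded supremum of continuous seminorms is continuous.
  let _ : TopologicalSpace V := SeminormFamily.moduleFilterBasis p |>.topology
  have hV : WithSeminorms p := ⟨rfl⟩
  have := hV.topologicalAddGroup
  have := hV.continuousSMul
  let _ : UniformSpace V := IsTopologicalAddGroup.rightUniformSpace V
  have : IsUniformAddGroup V := isUniformAddGroup_of_addCommGroup
  have : CompleteSpace V := hV.completeSpace_of_summable hp hc
  have : FirstCountableTopology V := hV.firstCountableTopology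
  have : (uniformity V).IsCountablyGenerated := IsUniformAddGroup.uniformity_countably_generated
  have hbs : BddAbove (range fun i => (normSeminorm ℂ ℂ).comp (T i)) := by
    rw [Seminorm.bddAbove_range_iff]
    exact hb
  have hq : Continuous (⨆ i, (normSeminorm ℂ ℂ).comp (T i)) := by
    refine Seminorm.continuous_iSup _ (fun i => ?_) hbs
    obtain ⟨C, N, h⟩ := hT i
    refine Seminorm.continuous_of_le (q := (max C 0).toNNReal • p N) ?_ fun x => ?_
    · exact (continuous_const.mul (hV.continuous_seminorm N) : Continuous
        fun x => ((max C 0).toNNReal : ℝ) * p N x)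
    · refine (h x).trans ?_
      have : (max C 0).toNNReal • p N x = max C 0 * p N x := by
        rw [NNReal.smul_def, Real.coe_toNNReal _ (le_max_right _ _), smul_eq_mul]
      rw [smul_apply, this]
      exact mul_le_mul_of_nonneg_right (le_max_left _ _) (apply_nonneg _ _)
  obtain ⟨s, C, -, h⟩ := Seminorm.bound_of_continuous hV (⨆ i, (normSeminorm ℂ ℂ).comp (T i))
    (by rwa [Seminorm.coe_iSup_eq hbs])
  obtain ⟨N, hN⟩ := Seminorm.finset_sup_le_of_monotone hp s
  refine ⟨C, N, C.2, fun i x => ?_⟩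
  calc ‖T i x‖ ≤ (⨆ i, (normSeminorm ℂ ℂ).comp (T i)) x :=
        (le_ciSup hbs i : (normSeminorm ℂ ℂ).comp (T i) ≤ _) x
    _ ≤ C * s.sup p x := h x
    _ ≤ C * p N x := mul_le_mul_of_nonneg_left (hN x) C.2

/-- A family of functionals `B φ`, each continuous, and whose values at each `x` are controlled by
one of the increasing gauges `r N φ`, is controlled by a product of a seminorm and a gauge. -/
theorem Seminorm.exists_bilinear_bound {V Φ : Type*} [AddCommGroup V] [Module ℂ V]
    {p : ℕ → Seminorm ℂ V} (hp : Monotone p)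
    (hc : ∀ f : ℕ → V, (∀ N, Summable fun i => p N (f i)) →
      ∃ g, ∀ N, Tendsto (fun r => p N (g - ∑ i ∈ Finset.range r, f i)) atTop (𝓝 0))
    (B : Φ → V →ₗ[ℂ] ℂ) (hB : ∀ φ, ∃ C N, ∀ x, ‖B φ x‖ ≤ C * p N x)
    (r : ℕ → Φ → ℝ) (hr : Monotone r) (hr0 : ∀ N φ, 0 ≤ r N φ)
    (hx : ∀ x, ∃ C N, ∀ φ, ‖B φ x‖ ≤ C * r N φ) :
    ∃ C, 0 < C ∧ ∃ N, ∀ x φ, ‖B φ x‖ ≤ C * p N x * r N φ := by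
  by_contra! hcon
  have key : ∀ N : ℕ, ∃ (c : ℝ) (x : V) (φ : Φ),
      0 ≤ c ∧ c * r N φ ≤ 1 ∧ (N : ℝ) * p N x < c * ‖B φ x‖ := by
    intro N
    -- `N + 1` rather than `N`, since the constant being refuted must be positive also for `N = 0`.
    obtain ⟨x, φ, h⟩ := hcon (N + 1) (by positivity) N
    have hpx : 0 ≤ p N x := apply_nonneg _ _
    -- If the gauge of `φ` vanishes, the constraint on `c` is void and `c` may be as large as
    -- needed; otherwise `c` normalises the gauge to `1`.
    rcases (hr0 N φ).eq_or_lt with h0 | h0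
    · rw [← h0, mul_zero] at h
      refine ⟨(N * p N x + 1) / ‖B φ x‖, x, φ, by positivity, by simp [← h0], ?_⟩
      rw [div_mul_cancel₀ _ h.ne']
      exact lt_add_one _
    · refine ⟨(r N φ)⁻¹, x, φ, by positivity, (inv_mul_cancel₀ h0.ne').le, ?_⟩
      rw [← div_eq_inv_mul, lt_div_iff₀ h0]
      refine lt_of_le_of_lt ?_ h
      gcongr
      linarith
  choose c x φ hc0 hc1 hlt using key
  have hnorm : ∀ N y, ‖((c N : ℂ) • B (φ N)) y‖ = c N * ‖B (φ N) y‖ := by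
    intro N y
    rw [LinearMap.smul_apply, norm_smul, Complex.norm_real, Real.norm_of_nonneg (hc0 N)]
  obtain ⟨C, k, hC0, hC⟩ := Seminorm.exists_uniform_bound hp hc
    (fun N => (c N : ℂ) • B (φ N)) (fun N => by
      obtain ⟨C, k, h⟩ := hB (φ N)
      refine ⟨c N * C, k, fun y => ?_⟩
      rw [hnorm, mul_assoc]
      exact mul_le_mul_of_nonneg_left (h y) (hc0 N)) (fun y => by
      obtain ⟨C, k, h⟩ := hx y
      -- The gauge controlling `y` has a fixed index `k`, so it is dominated by `r N` only for `N ≥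
      -- k`. A bound on the tail of a sequence suffices.
      refine IsBoundedUnder.bddAbove_range (f := fun N => ‖((c N : ℂ) • B (φ N)) y‖)
        ⟨max C 0, ?_⟩
      rw [eventually_map]
      filter_upwards [eventually_ge_atTop k] with N hN
      rw [hnorm]
      calc c N * ‖B (φ N) y‖ ≤ c N * (max C 0 * r N (φ N)) := by
            refine mul_le_mul_of_nonneg_left ((h (φ N)).trans ?_) (hc0 N)
            exact mul_le_mul (le_max_left _ _) (hr hN _) (hr0 _ _) (le_max_right _ _)
        _ = max C 0 * (c N * r N (φ N)) := by ring
        _ ≤ max C 0 * 1 := mul_le_mul_of_nonneg_left (hc1 N) (le_max_right _ _)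
        _ = max C 0 := mul_one _)
  -- The uniform bound, tested on `x N` with `N` beyond both its constant and its index, contradicts
  -- the choice of `x N`.
  obtain ⟨N, hN⟩ := exists_nat_ge (max C k)
  have h1 := hC N (x N)
  rw [hnorm] at h1
  have hkN : k ≤ N := by exact_mod_cast (le_max_right _ _).trans hN
  have h2 : C * p k (x N) ≤ N * p N (x N) :=
    mul_le_mul ((le_max_left _ _).trans hN) (hp hkN _) (apply_nonneg _ _) (by positivity)
  exact absurd (hlt N) (not_lt.2 (h1.trans h2))

/-- A series of smooth functions on an open convex set, with summable bounds on the derivatives of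
each order, may be differentiated term by term. -/
theorem contDiffOn_tsum_of_convex {E F : Type*} [NormedAddCommGroup E] [NormedSpace ℝ E]
    [NormedAddCommGroup F] [NormedSpace ℝ F] [CompleteSpace F] {s : Set E} (hs : IsOpen s)
    (hs' : Convex ℝ s) {f : ℕ → E → F} (hf : ∀ i, ContDiffOn ℝ (⊤ : ℕ∞) (f i) s) {v : ℕ → ℕ → ℝ}
    (hv : ∀ k, Summable (v k))
    (hle : ∀ k i, ∀ z ∈ s, ‖iteratedFDeriv ℝ k (f i) z‖ ≤ v k i) :
    ContDiffOn ℝ (⊤ : ℕ∞) (fun z => ∑' i, f i z) s ∧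
      ∀ k, ∀ z ∈ s, iteratedFDeriv ℝ k (fun z => ∑' i, f i z) z =
        ∑' i, iteratedFDeriv ℝ k (f i) z := by
  have hsum : ∀ k, ∀ z ∈ s, Summable fun i => iteratedFDeriv ℝ k (f i) z := fun k z hz =>
    Summable.of_norm_bounded (hv k) fun i => hle k i z hz
  have hder : ∀ k, ∀ z ∈ s, HasFDerivAt (fun z => ∑' i, iteratedFDeriv ℝ k (f i) z)
      (∑' i, iteratedFDeriv ℝ (k + 1) (f i) z).curryLeft z := by
    intro k z hz
    have h1 : ∀ i, ∀ y ∈ s, HasFDerivAt (iteratedFDeriv ℝ k (f i))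
        (iteratedFDeriv ℝ (k + 1) (f i) y).curryLeft y := by
      intro i y hy
      have h2 : DifferentiableAt ℝ (iteratedFDeriv ℝ k (f i)) y :=
        ((hf i).contDiffAt (hs.mem_nhds hy)).differentiableAt_iteratedFDeriv
          (by exact_mod_cast WithTop.coe_lt_top k)
      have h3 := h2.hasFDerivAt
      rwa [fderiv_iteratedFDeriv] at h3
    have h4 := hasFDerivAt_tsum_of_isPreconnected (hv (k + 1)) hs hs'.isPreconnected h1
      (fun i y hy => by
        have : ‖(iteratedFDeriv ℝ (k + 1) (f i) y).curryLeft‖ =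
            ‖iteratedFDeriv ℝ (k + 1) (f i) y‖ := ContinuousMultilinearMap.curryLeft_norm _
        rw [this]; exact hle _ _ _ hy) hz (hsum k z hz) hz
    refine h4.congr_fderiv (Eq.symm ?_)
    exact (continuousMultilinearCurryLeftEquiv ℝ (fun _ : Fin (k + 1) => E) F
      ).toContinuousLinearEquiv.map_tsum
  -- The sums of the derivatives form a Taylor series of the sum; uniqueness of such a series on an
  -- open set then identifies the derivatives.
  have hT : HasFTaylorSeriesUpToOn ((⊤ : ℕ∞) : WithTop ℕ∞) (fun z => ∑' i, f i z)
      (fun z k => ∑' i, iteratedFDeriv ℝ k (f i) z) s := by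
    refine ⟨fun z hz => ?_, fun k _ z hz => (hder k z hz).hasFDerivWithinAt, fun k _ z hz =>
      (hder k z hz).continuousAt.continuousWithinAt⟩
    exact (continuousMultilinearCurryFin0 ℝ E F).toContinuousLinearEquiv.map_tsum
  refine ⟨hT.contDiffOn, fun k z hz => ?_⟩
  rw [← iteratedFDerivWithin_of_isOpen k hs hz]
  exact (hT.eq_iteratedFDerivWithin_of_uniqueDiffOn (by exact_mod_cast le_top) hs.uniqueDiffOn
    hz).symm

end FunctionalAnalysis

/-! ### Forms in coordinates, periodicity, and comparison of seminorms. -/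

namespace InvolutiveSystem

noncomputable section

open scoped Manifold ContDiff Topology
open Set MeasureTheory Filter

variable {n : ℕ} {M : Type*} [TopologicalSpace M] [ChartedSpace (Euc n) M] {𝔄 : OrientedAtlas n M}
  {m q : ℕ}

/-- The coordinate expression of a form at a point of the chart is a linear isomorphic image of its
value at that point. -/
theorem exists_coordForm_equiv (𝔄 : OrientedAtlas n M) (q j : ℕ) {y : Euc n}
    (hy : y ∈ (𝔄.chart j).target) :
    ∃ Ψ : ((Euc n) [⋀^Fin q]→L[ℝ] ℂ) ≃L[ℝ] ((Euc n) [⋀^Fin q]→L[ℝ] ℂ),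
      ∀ α : ∀ t : M, (TangentSpace (𝓡 n) t) [⋀^Fin q]→L[ℝ] ℂ,
        coordForm (𝔄.chart j) α y = Ψ (α ((𝔄.chart j).symm y)) := by
  have he : (𝔄.chart j).MDifferentiable (𝓡 n) (𝓡 n) :=
    ⟨(contMDiffOn_of_mem_maximalAtlas (𝔄.mem_maximalAtlas j)).mdifferentiableOn (by simp),
      (contMDiffOn_symm_of_mem_maximalAtlas (𝔄.mem_maximalAtlas j)).mdifferentiableOn (by simp)⟩
  let A : Euc n ≃L[ℝ] Euc n := he.symm.mfderiv (x := y) hy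
  refine ⟨A.symm.continuousAlternatingMapCongrLeft, fun α => ?_⟩
  rfl

/-- Reducing each coordinate modulo `2π` shifts it by a multiple of the period. The seminorms take
suprema over the box alone; this shift extends their control to all of `ℝᵐ`. -/
theorem exists_add_mem_torusBox (x : Fin m → ℝ) :
    ∃ a : Fin m → ℝ, x + a ∈ torusBox m ∧ ∀ x' : Fin m → ℝ, torusMk (x' + a) = torusMk x' := by
  refine ⟨fun k => toIcoMod Real.two_pi_pos 0 (x k) - x k, ⟨fun k => ?_, fun k => ?_⟩,
    fun x' => funext fun k => ?_⟩
  · rw [Pi.add_apply, add_sub_cancel]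
    exact left_le_toIcoMod Real.two_pi_pos 0 (x k)
  · rw [Pi.add_apply, add_sub_cancel]
    exact (toIcoMod_lt_right Real.two_pi_pos 0 (x k)).le.trans_eq (zero_add _)
  · have : toIcoMod Real.two_pi_pos 0 (x k) - x k =
        -(toIcoDiv Real.two_pi_pos 0 (x k)) • (2 * Real.pi) := by
      rw [toIcoMod, neg_smul]; ring
    simp only [torusMk, Pi.add_apply, this, AddCircle.coe_add, AddCircle.coe_zsmul,
      AddCircle.coe_period, smul_zero, add_zero]

/-- The derivatives of the lift are bounded over all of `ℝᵐ`, by periodicity. -/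
theorem norm_iteratedFDeriv_liftCoord_le (f : SmoothForm 𝔄 m q) (P : ChartCompact 𝔄) (i : ℕ)
    {z : Euc n × (Fin m → ℝ)} (hz : z.1 ∈ (𝔄.chart P.idx) '' P.carrier) :
    ‖iteratedFDeriv ℝ i (liftCoord (𝔄.chart P.idx) f.val) z‖ ≤ derivSeminorm m q P i f := by
  obtain ⟨a, ha, ha'⟩ := exists_add_mem_torusBox z.2
  have h1 : (fun z' => liftCoord (𝔄.chart P.idx) f.val (z' + (0, a))) =
      liftCoord (𝔄.chart P.idx) f.val := by
    funext z'
    have h : ∀ u v : Torus m, u = v → coordForm (𝔄.chart P.idx) (fun t => f.val (t, u)) =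
        coordForm (𝔄.chart P.idx) (fun t => f.val (t, v)) := by
      rintro u _ rfl; rfl
    simp only [liftCoord, Prod.fst_add, Prod.snd_add, add_zero, h _ _ (ha' z'.2)]
  rw [← h1, iteratedFDeriv_comp_add_right]
  have h2 : z + (0, a) ∈ P.coordSet m := ⟨by simpa using hz, ha⟩
  exact le_ciSup (bddAbove_iteratedFDeriv f P i) ⟨_, h2⟩

theorem derivSeminorm_le_of_forall (f : SmoothForm 𝔄 m q) (P : ChartCompact 𝔄) (i : ℕ) {c : ℝ}
    (hc : 0 ≤ c) (h : ∀ z ∈ P.coordSet m,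
      ‖iteratedFDeriv ℝ i (liftCoord (𝔄.chart P.idx) f.val) z‖ ≤ c) :
    derivSeminorm m q P i f ≤ c :=
  Real.iSup_le (fun z => h z z.2) hc

theorem derivSeminorm_mono {P Q : ChartCompact 𝔄} (h : P.idx = Q.idx)
    (hs : P.carrier ⊆ Q.carrier) (i : ℕ) : derivSeminorm m q P i ≤ derivSeminorm m q Q i := by
  intro f
  refine derivSeminorm_le_of_forall f P i (apply_nonneg _ _) fun z hz => ?_
  rw [h]
  exact norm_iteratedFDeriv_liftCoord_le f Q i (h ▸ image_mono hs hz.1)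

theorem derivSeminorm_le_formSeminorm (s : Finset (ChartCompact 𝔄) × ℕ) {P : ChartCompact 𝔄}
    (hP : P ∈ s.1) {i : ℕ} (hi : i ≤ s.2) : derivSeminorm m q P i ≤ formSeminorm 𝔄 m q s :=
  (Finset.le_sup (f := fun i => derivSeminorm m q P i)
    (Finset.mem_range.2 (Nat.lt_succ_of_le hi))).trans
    (Finset.single_le_sum (f := fun P => (Finset.range (s.2 + 1)).sup
      (fun i => derivSeminorm m q P i)) (by intro _ _ f; exact apply_nonneg _ f) hP)

theorem formSeminorm_le_sum (s : Finset (ChartCompact 𝔄) × ℕ) :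
    formSeminorm 𝔄 m q s ≤
      ∑ P ∈ s.1, ∑ i ∈ Finset.range (s.2 + 1), derivSeminorm m q P i :=
  Finset.sum_le_sum fun P _ => Seminorm.finset_sup_le_sum (fun i => derivSeminorm m q P i) _

/-! ### Convergence of absolutely convergent series of smooth forms. -/

section Series

theorem summable_derivSeminorm {f : ℕ → SmoothForm 𝔄 m q}
    (hf : ∀ s, Summable fun i => formSeminorm 𝔄 m q s (f i)) (P : ChartCompact 𝔄) (k : ℕ) :
    Summable fun i => derivSeminorm m q P k (f i) :=
  (hf ({P}, k)).of_nonneg_of_le (fun _ => apply_nonneg _ _) fun i =>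
    derivSeminorm_le_formSeminorm ({P}, k) (Finset.mem_singleton_self P) le_rfl (f i)

/-- The pointwise sum of a series of forms. -/
def tsumForm (f : ℕ → SmoothForm 𝔄 m q) : RawForm n M m q :=
  fun p => (∑' i, ((f i).val p : (Euc n) [⋀^Fin q]→L[ℝ] ℂ) : (Euc n) [⋀^Fin q]→L[ℝ] ℂ)

/-- On each fibre, passing to coordinates is a continuous linear isomorphism, so it commutes with
`∑'` whether or not the series converges. -/
theorem liftCoord_tsumForm (f : ℕ → SmoothForm 𝔄 m q) (j : ℕ) {z : Euc n × (Fin m → ℝ)}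
    (hz : z.1 ∈ (𝔄.chart j).target) :
    liftCoord (𝔄.chart j) (tsumForm f) z = ∑' i, liftCoord (𝔄.chart j) (f i).val z := by
  obtain ⟨Ψ, hΨ⟩ := exists_coordForm_equiv 𝔄 q j hz
  simp only [liftCoord, hΨ]
  exact Ψ.map_tsum

/-- Every point of a chart has a convex neighbourhood over which a compact set of the chart lies. -/
theorem exists_ball_chartCompact (𝔄 : OrientedAtlas n M) (j : ℕ) {y : Euc n}
    (hy : y ∈ (𝔄.chart j).target) :
    ∃ r > 0, ∃ P : ChartCompact 𝔄, P.idx = j ∧ Metric.ball y r ⊆ (𝔄.chart j).target ∧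
      Metric.ball y r ⊆ (𝔄.chart j) '' P.carrier := by
  obtain ⟨r, hr, hsub⟩ := Metric.nhds_basis_closedBall.mem_iff.1
    ((𝔄.chart j).open_target.mem_nhds hy)
  refine ⟨r, hr, ⟨j, (𝔄.chart j).symm '' Metric.closedBall y r,
    (isCompact_closedBall y r).image_of_continuousOn ((𝔄.chart j).continuousOn_symm.mono hsub), ?_⟩,
    rfl, Metric.ball_subset_closedBall.trans hsub, ?_⟩
  · rintro _ ⟨y', hy', rfl⟩
    exact (𝔄.chart j).map_target (hsub hy')
  · intro y' hy'
    have h := Metric.ball_subset_closedBall hy'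
    exact ⟨_, mem_image_of_mem _ h, (𝔄.chart j).right_inv (hsub h)⟩

/-- Near `z`, a ball times `ℝᵐ` is open and convex, and by periodicity the seminorms of a single
compact set bound every derivative of every term there, so the series may be differentiated term by
term. -/
theorem iteratedFDeriv_tsumForm {f : ℕ → SmoothForm 𝔄 m q}
    (hf : ∀ s, Summable fun i => formSeminorm 𝔄 m q s (f i)) (j : ℕ) {z : Euc n × (Fin m → ℝ)}
    (hz : z.1 ∈ (𝔄.chart j).target) :
    ContDiffAt ℝ ∞ (liftCoord (𝔄.chart j) (tsumForm f)) z ∧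
      ∀ k, iteratedFDeriv ℝ k (liftCoord (𝔄.chart j) (tsumForm f)) z =
        ∑' i, iteratedFDeriv ℝ k (liftCoord (𝔄.chart j) (f i).val) z := by
  obtain ⟨r, hr, P, rfl, h1, h2⟩ := exists_ball_chartCompact 𝔄 j hz
  have ho : IsOpen (Metric.ball z.1 r ×ˢ (univ : Set (Fin m → ℝ))) :=
    Metric.isOpen_ball.prod isOpen_univ
  have hzm : z ∈ Metric.ball z.1 r ×ˢ (univ : Set (Fin m → ℝ)) :=
    ⟨Metric.mem_ball_self hr, mem_univ _⟩
  obtain ⟨h3, h4⟩ := contDiffOn_tsum_of_convex ho ((convex_ball _ _).prod convex_univ)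
    (f := fun i => liftCoord (𝔄.chart P.idx) (f i).val)
    (v := fun k i => derivSeminorm m q P k (f i))
    (fun i => ((f i).smooth P.idx).mono (prod_mono h1 Subset.rfl))
    (fun k => summable_derivSeminorm hf P k)
    (fun k i z' hz' => norm_iteratedFDeriv_liftCoord_le (f i) P k (h2 hz'.1))
  have h5 : liftCoord (𝔄.chart P.idx) (tsumForm f) =ᶠ[𝓝 z]
      fun z' => ∑' i, liftCoord (𝔄.chart P.idx) (f i).val z' := by
    filter_upwards [ho.mem_nhds hzm] with z' hz'
    exact liftCoord_tsumForm f P.idx (h1 hz'.1)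
  refine ⟨(h3.contDiffAt (ho.mem_nhds hzm)).congr_of_eventuallyEq h5, fun k => ?_⟩
  rw [h5.iteratedFDeriv ℝ k |>.eq_of_nhds]
  exact h4 k z hzm

/-- The derivative of the remainder is the tail of the series of derivatives, which is bounded term
by term. The right side tends to `0` as `r` grows. -/
theorem derivSeminorm_sub_sum_le {f : ℕ → SmoothForm 𝔄 m q}
    (hf : ∀ s, Summable fun i => formSeminorm 𝔄 m q s (f i)) {g : SmoothForm 𝔄 m q}
    (hg : g.val = tsumForm f) (P : ChartCompact 𝔄) (k r : ℕ) :
    derivSeminorm m q P k (g - ∑ i ∈ Finset.range r, f i) ≤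
      ∑' i, derivSeminorm m q P k (f (i + r)) := by
  have hs := summable_derivSeminorm hf P k
  refine derivSeminorm_le_of_forall _ _ _ (tsum_nonneg fun i => apply_nonneg _ _) fun z hz => ?_
  have hk : (k : WithTop ℕ∞) ≤ ∞ := by exact_mod_cast le_top
  have hle : ∀ i, ‖iteratedFDeriv ℝ k (liftCoord (𝔄.chart P.idx) (f i).val) z‖ ≤
      derivSeminorm m q P k (f i) := fun i => norm_iteratedFDeriv_liftCoord_le (f i) P k hz.1
  have hS : ∀ r, iteratedFDeriv ℝ k
      (liftCoord (𝔄.chart P.idx) (∑ i ∈ Finset.range r, f i).val) z =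
      ∑ i ∈ Finset.range r, iteratedFDeriv ℝ k (liftCoord (𝔄.chart P.idx) (f i).val) z := by
    intro r
    induction r with
    | zero =>
      rw [Finset.sum_range_zero, Finset.sum_range_zero]
      have : liftCoord (𝔄.chart P.idx) (0 : SmoothForm 𝔄 m q).val = fun _ => 0 := rfl
      rw [this, iteratedFDeriv_fun_zero]
      rfl
    | succ r ih =>
      rw [Finset.sum_range_succ, Finset.sum_range_succ, ← ih, SmoothForm.val_add, liftCoord_add]
      exact iteratedFDeriv_add_apply ((SmoothForm.contDiffAt _ P hz).of_le hk)
        ((SmoothForm.contDiffAt _ P hz).of_le hk)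
  have hg' : iteratedFDeriv ℝ k (liftCoord (𝔄.chart P.idx) g.val) z =
      ∑' i, iteratedFDeriv ℝ k (liftCoord (𝔄.chart P.idx) (f i).val) z := by
    rw [hg]
    exact (iteratedFDeriv_tsumForm hf P.idx (P.coordSet_subset m hz).1).2 k
  have hsplit : g = (g - ∑ i ∈ Finset.range r, f i) + ∑ i ∈ Finset.range r, f i := by abel
  have h1 : iteratedFDeriv ℝ k (liftCoord (𝔄.chart P.idx)
      (g - ∑ i ∈ Finset.range r, f i).val) z =
      ∑' i, iteratedFDeriv ℝ k (liftCoord (𝔄.chart P.idx) (f (i + r)).val) z := by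
    have h2 := hg'
    rw [hsplit, SmoothForm.val_add, liftCoord_add, iteratedFDeriv_add_apply
      ((SmoothForm.contDiffAt _ P hz).of_le hk) ((SmoothForm.contDiffAt _ P hz).of_le hk), hS,
      ← (Summable.of_norm_bounded hs hle).sum_add_tsum_nat_add r, add_comm] at h2
    exact add_left_cancel h2
  rw [h1]
  exact tsum_of_norm_bounded ((summable_nat_add_iff r).2 hs).hasSum fun i => hle (i + r)

/-- An absolutely convergent series of smooth forms converges to its pointwise sum. -/
theorem exists_tendsto_of_summable {f : ℕ → SmoothForm 𝔄 m q}
    (hf : ∀ s, Summable fun i => formSeminorm 𝔄 m q s (f i)) :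
    ∃ g : SmoothForm 𝔄 m q, g.val = tsumForm f ∧ ∀ s, Tendsto
      (fun r => formSeminorm 𝔄 m q s (g - ∑ i ∈ Finset.range r, f i)) atTop (𝓝 0) := by
  refine ⟨⟨tsumForm f, fun j z hz =>
    (iteratedFDeriv_tsumForm hf j hz.1).1.contDiffWithinAt⟩, rfl, fun s => ?_⟩
  have h0 : Tendsto (fun r => ∑ P ∈ s.1, ∑ k ∈ Finset.range (s.2 + 1),
      ∑' i, derivSeminorm m q P k (f (i + r))) atTop (𝓝 0) := by
    rw [← Finset.sum_const_zero (s := s.1)]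
    refine tendsto_finsetSum _ fun P _ => ?_
    rw [← Finset.sum_const_zero (s := Finset.range (s.2 + 1))]
    exact tendsto_finsetSum _ fun k _ =>
      tendsto_sum_nat_add fun i => derivSeminorm m q P k (f i)
  refine squeeze_zero (fun _ => apply_nonneg _ _) (fun r => ?_) h0
  refine (formSeminorm_le_sum s _).trans ?_
  simp only [sum_apply]
  exact Finset.sum_le_sum fun P _ => Finset.sum_le_sum fun k _ =>
    derivSeminorm_sub_sum_le hf rfl P k r

end Series

/-! ### A countable cofinal family of seminorms. -/

section Cofinal

/-- An increasing sequence of compact sets which exhausts the domain of a chart. -/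
theorem exists_chartCompact_exhaustion [SecondCountableTopology M] (𝔄 : OrientedAtlas n M)
    (j : ℕ) : ∃ Q : ℕ → ChartCompact 𝔄, (∀ N, (Q N).idx = j) ∧
      (Monotone fun N => (Q N).carrier) ∧
      ∀ P : ChartCompact 𝔄, P.idx = j → ∃ N, P.carrier ⊆ (Q N).carrier := by
  have : LocallyCompactSpace M := ChartedSpace.locallyCompactSpace (Euc n) M
  have : LocallyCompactSpace (𝔄.chart j).source := (𝔄.chart j).open_source.locallyCompactSpace
  let K := CompactExhaustion.choice (𝔄.chart j).source
  refine ⟨fun N => ⟨j, Subtype.val '' K N, (K.isCompact N).image continuous_subtype_val,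
    by rintro _ ⟨t, -, rfl⟩; exact t.2⟩, fun _ => rfl, fun a b h => image_mono (K.subset h), ?_⟩
  rintro ⟨_, L, hL, hsub⟩ rfl
  obtain ⟨N, hN⟩ := K.exists_superset_of_isCompact
    (Topology.IsInducing.subtypeVal.isCompact_preimage' hL
      (by rwa [Subtype.range_coe]))
  exact ⟨N, fun t ht => ⟨⟨t, hsub ht⟩, hN ht, rfl⟩⟩

/-- The standard seminorms contain a cofinal increasing sequence. -/
theorem exists_cofinal_formSeminorm [SecondCountableTopology M] (𝔄 : OrientedAtlas n M) :
    ∃ S : ℕ → Finset (ChartCompact 𝔄) × ℕ, ∀ m q : ℕ,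
      (Monotone fun N => formSeminorm 𝔄 m q (S N)) ∧
      ∀ s, ∃ C : NNReal, ∃ N, formSeminorm 𝔄 m q s ≤ C • formSeminorm 𝔄 m q (S N) := by
  classical
  choose Q hidx hmono hcof using exists_chartCompact_exhaustion 𝔄
  -- A `ChartCompact` remembers its chart index, so different charts never collapse in the `Finset`
  -- image and the seminorm is a sum over `j`.
  have hinj : ∀ N, Function.Injective fun j => Q j N := fun N i j h => by
    rw [← hidx i N, ← hidx j N]; exact congrArg ChartCompact.idx h
  let S : ℕ → Finset (ChartCompact 𝔄) × ℕ :=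
    fun N => ((Finset.range (N + 1)).image fun j => Q j N, N)
  have hS : ∀ m q N, formSeminorm 𝔄 m q (S N) = ∑ j ∈ Finset.range (N + 1),
      (Finset.range (N + 1)).sup (fun i => derivSeminorm m q (Q j N) i) := fun m q N =>
    Finset.sum_image fun i _ j _ h => hinj N h
  refine ⟨S, fun m q => ?_⟩
  have hmon : Monotone fun N => formSeminorm 𝔄 m q (S N) := by
    intro N N' h
    simp only [hS]
    refine le_trans (Finset.sum_le_sum fun j _ => ?_)
      (Finset.sum_le_sum_of_subset_of_nonneg
        (Finset.range_mono (Nat.succ_le_succ h)) fun _ _ _ f => apply_nonneg _ f)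
    refine Finset.sup_le fun i hi => le_trans ?_
      (Finset.le_sup (f := fun i => derivSeminorm m q (Q j N') i)
        (Finset.range_mono (Nat.succ_le_succ h) hi))
    exact derivSeminorm_mono ((hidx j N).trans (hidx j N').symm) (hmono j h) i
  refine ⟨hmon, fun s => ?_⟩
  choose! N hN using fun P : ChartCompact 𝔄 => hcof P.idx P rfl
  -- `N'` exceeds the order, every chart index and every exhaustion level that occurs. Each summand
  -- of `s` is then at most the seminorm of `S N'`, whence the constant `s.1.card`.
  let N' := max s.2 (s.1.sup fun P => max P.idx (N P))
  refine ⟨s.1.card, N', ?_⟩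
  have hP : ∀ P ∈ s.1, (Finset.range (s.2 + 1)).sup (fun i => derivSeminorm m q P i) ≤
      formSeminorm 𝔄 m q (S N') := by
    intro P hP
    have h1 : max P.idx (N P) ≤ N' :=
      (Finset.le_sup (f := fun P => max P.idx (N P)) hP).trans (le_max_right _ _)
    refine Finset.sup_le fun i hi => ?_
    refine le_trans (derivSeminorm_mono (Q := Q P.idx N') (hidx _ _).symm
      ((hN P).trans (hmono _ ((le_max_right _ _).trans h1))) i)
      (derivSeminorm_le_formSeminorm (S N') (Finset.mem_image_of_mem _ ?_) ?_)
    · exact Finset.mem_range.2 (Nat.lt_succ_of_le ((le_max_left _ _).trans h1))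
    · exact (Nat.le_of_lt_succ (Finset.mem_range.1 hi)).trans (le_max_left _ _)
  refine (Finset.sum_le_card_nsmul _ _ _ hP).trans (le_of_eq ?_)
  ext f
  simp [NNReal.smul_def]

end Cofinal

/-! ### Continuity on the torus and coefficients of top forms. -/

theorem isOpenQuotientMap_torusMk : IsOpenQuotientMap (torusMk (m := m)) :=
  IsOpenQuotientMap.piMap fun _ => QuotientAddGroup.isOpenQuotientMap_mk

/-- Smoothness is defined on the lift to `M × ℝᵐ`. Continuity descends because the covering map is
open, so that its product with the identity is still a quotient map. -/
theorem SmoothFun.continuous (φ : SmoothFun n M m) : Continuous φ.toFun :=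
  (IsOpenQuotientMap.id.prodMap isOpenQuotientMap_torusMk).isQuotientMap.continuous_iff.2
    φ.smooth.continuous

theorem norm_topCoeff_le (f : SmoothForm 𝔄 m n) (P : ChartCompact 𝔄) {z : Euc n × Torus m}
    (hz : z.1 ∈ (𝔄.chart P.idx) '' P.carrier) :
    ‖topCoeff (𝔄.chart P.idx) f.val z‖ ≤ derivSeminorm m n P 0 f := by
  obtain ⟨y, x⟩ := z
  obtain ⟨x, rfl⟩ := torusMk_surjective x
  have h := norm_iteratedFDeriv_liftCoord_le f P 0 (z := (y, x)) hz
  rw [norm_iteratedFDeriv_zero] at h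
  refine le_trans ?_ h
  refine (ContinuousAlternatingMap.le_opNorm
    (liftCoord (𝔄.chart P.idx) f.val (y, x)) fun i => EuclideanSpace.single i (1 : ℝ)).trans ?_
  simp

theorem continuousOn_topCoeff (f : SmoothForm 𝔄 m n) (j : ℕ) :
    ContinuousOn (topCoeff (𝔄.chart j) f.val) ((𝔄.chart j).target ×ˢ univ) := by
  have ho : IsOpen ((𝔄.chart j).target ×ˢ (univ : Set (Torus m))) :=
    (𝔄.chart j).open_target.prod isOpen_univ
  rw [(IsOpenQuotientMap.id.prodMap
    (isOpenQuotientMap_torusMk (m := m))).isQuotientMap.continuousOn_isOpen_iff ho]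
  have h : ContinuousOn (fun z => liftCoord (𝔄.chart j) f.val z
      fun i => EuclideanSpace.single i (1 : ℝ)) ((𝔄.chart j).target ×ˢ univ) := by
    intro z hz
    exact (ContinuousAlternatingMap.apply ℝ (Euc n) ℂ
      (fun i : Fin n => EuclideanSpace.single i (1 : ℝ))).continuous.continuousAt.comp_continuousWithinAt
      ((f.smooth j).continuousOn z hz)
  exact h

theorem SupportedIn.add {K : Set M} {f g : SmoothForm 𝔄 m n} (hf : SupportedIn f K)
    (hg : SupportedIn g K) : SupportedIn (f + g) K := fun p hp => by
  rw [SmoothForm.val_add, Pi.add_apply, hf p hp, hg p hp, add_zero]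

theorem SupportedIn.smul {K : Set M} {f : SmoothForm 𝔄 m n} (c : ℂ) (hf : SupportedIn f K) :
    SupportedIn (c • f) K := fun p hp => by
  rw [SmoothForm.val_smul, Pi.smul_apply, hf p hp]
  exact smul_zero (A := (Euc n) [⋀^Fin n]→L[ℝ] ℂ) c

/-! ### The pairing, and the space of compatible forms supported in a compact set. -/

section Pairing

variable [IsManifold (𝓡 n) ∞ M] [T2Space M] [SecondCountableTopology M]

theorem OrientedAtlas.tsupport_partition_subset (𝔄 : OrientedAtlas n M) (j : ℕ) :
    tsupport (𝔄.partition j) ⊆ (𝔄.chart j).source :=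
  Classical.choose_spec 𝔄.exists_partition j

/-- The part of a compact set where the `j`-th function of the partition of unity lives. -/
def partitionCompact (𝔄 : OrientedAtlas n M) {K : Set M} (hK : IsCompact K) (j : ℕ) :
    ChartCompact 𝔄 where
  idx := j
  carrier := K ∩ tsupport (𝔄.partition j)
  isCompact := hK.inter_right (isClosed_tsupport _)
  subset := inter_subset_right.trans (𝔄.tsupport_partition_subset j)

/-- The finitely many indices of the partition of unity which matter on a compact set. -/
def partitionIndices (𝔄 : OrientedAtlas n M) {K : Set M} (hK : IsCompact K) : Finset ℕ :=
  (𝔄.partition.locallyFinite.finite_nonempty_inter_compact hK).toFinset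

/-- The product of `φ f` and the `j`-th function of the partition of unity, in coordinates. -/
def localDensity (f : SmoothForm 𝔄 m n) (φ : SmoothFun n M m) (j : ℕ) (z : Euc n × Torus m) : ℂ :=
  (𝔄.partition j ((𝔄.chart j).symm z.1) : ℂ) *
    (φ.toFun ((𝔄.chart j).symm z.1, z.2) * topCoeff (𝔄.chart j) f.val z)

theorem continuousOn_localDensity (f : SmoothForm 𝔄 m n) (φ : SmoothFun n M m) (j : ℕ) :
    ContinuousOn (localDensity f φ j) ((𝔄.chart j).target ×ˢ univ) := by
  have h1 : ContinuousOn (fun z : Euc n × Torus m => (𝔄.chart j).symm z.1)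
      ((𝔄.chart j).target ×ˢ univ) :=
    (𝔄.chart j).continuousOn_symm.comp continuousOn_fst fun z hz => hz.1
  refine ContinuousOn.mul ?_ (ContinuousOn.mul ?_ (continuousOn_topCoeff f j))
  · exact (Complex.continuous_ofReal.comp (𝔄.partition j).contMDiff.continuous).comp_continuousOn h1
  · exact φ.continuous.comp_continuousOn (h1.prodMk continuousOn_snd)

theorem localDensity_eq_zero {f : SmoothForm 𝔄 m n} {K : Set M} (hf : SupportedIn f K)
    (φ : SmoothFun n M m) (j : ℕ) {z : Euc n × Torus m}
    (hz : (𝔄.chart j).symm z.1 ∉ K ∩ Function.support (𝔄.partition j)) :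
    localDensity f φ j z = 0 := by
  by_cases h : (𝔄.chart j).symm z.1 ∈ K
  · have h2 : 𝔄.partition j ((𝔄.chart j).symm z.1) = 0 := by
      by_contra h3
      exact hz ⟨h, h3⟩
    simp [localDensity, h2]
  · have h2 : topCoeff (𝔄.chart j) f.val z = 0 := by
      have h3 := hf ((𝔄.chart j).symm z.1, z.2) h
      simp only [topCoeff, coordForm]
      rw [h3]
      rfl
    simp [localDensity, h2]

/-- Only finitely many partition functions meet `K`, and each integrand vanishes off the compact
image of `K ∩ tsupport`. On these compact sets the integrands are continuous, hence integrable,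
which is what linearity and continuity of the pairing in `f` rest on. -/
theorem pairing_eq_sum {K : Set M} (hK : IsCompact K) {f : SmoothForm 𝔄 m n}
    (hf : SupportedIn f K) (φ : SmoothFun n M m) :
    pairing f φ = ∑ j ∈ partitionIndices 𝔄 hK,
      ∫ z in ((𝔄.chart j) '' (partitionCompact 𝔄 hK j).carrier) ×ˢ (univ : Set (Torus m)),
        localDensity f φ j z := by
  have h1 : pairing f φ = ∑ᶠ j : ℕ, ∫ z in (𝔄.chart j).target ×ˢ (univ : Set (Torus m)),
      localDensity f φ j z := rfl
  rw [h1, finsum_eq_sum_of_support_subset]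
  · refine Finset.sum_congr rfl fun j _ => ?_
    refine setIntegral_eq_of_subset_of_forall_sdiff_eq_zero
      ((𝔄.chart j).open_target.measurableSet.prod MeasurableSet.univ) ?_ ?_
    · rintro ⟨_, x⟩ ⟨⟨t, ht, rfl⟩, -⟩
      exact ⟨(𝔄.chart j).map_source ((partitionCompact 𝔄 hK j).subset ht), mem_univ _⟩
    · rintro z ⟨hz, hz'⟩
      refine localDensity_eq_zero hf φ j fun h => hz' ⟨⟨_, ⟨h.1, subset_tsupport _ h.2⟩, ?_⟩,
        mem_univ _⟩
      exact (𝔄.chart j).right_inv hz.1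
  · intro j hj
    by_contra hj'
    refine hj ?_
    have h2 : ∀ z : Euc n × Torus m, localDensity f φ j z = 0 := fun z =>
      localDensity_eq_zero hf φ j fun h => hj' (by
        simp only [partitionIndices, Finite.coe_toFinset]
        exact ⟨_, h.2, h.1⟩)
    simp [h2]

theorem isCompact_partitionCompact_prod (𝔄 : OrientedAtlas n M) (m : ℕ) {K : Set M}
    (hK : IsCompact K) (j : ℕ) :
    IsCompact (((𝔄.chart j) '' (partitionCompact 𝔄 hK j).carrier) ×ˢ (univ : Set (Torus m))) :=
  ((partitionCompact 𝔄 hK j).isCompact.image_of_continuousOn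
    ((𝔄.chart j).continuousOn.mono (partitionCompact 𝔄 hK j).subset)).prod isCompact_univ

theorem integrableOn_localDensity {K : Set M} (hK : IsCompact K) (f : SmoothForm 𝔄 m n)
    (φ : SmoothFun n M m) (j : ℕ) :
    IntegrableOn (localDensity f φ j)
      (((𝔄.chart j) '' (partitionCompact 𝔄 hK j).carrier) ×ˢ (univ : Set (Torus m))) := by
  refine ContinuousOn.integrableOn_compact (isCompact_partitionCompact_prod 𝔄 m hK j)
    ((continuousOn_localDensity f φ j).mono ?_)
  rintro ⟨_, x⟩ ⟨⟨t, ht, rfl⟩, -⟩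
  exact ⟨(𝔄.chart j).map_source ((partitionCompact 𝔄 hK j).subset ht), mem_univ _⟩

theorem pairing_add {K : Set M} (hK : IsCompact K) {f g : SmoothForm 𝔄 m n}
    (hf : SupportedIn f K) (hg : SupportedIn g K) (φ : SmoothFun n M m) :
    pairing (f + g) φ = pairing f φ + pairing g φ := by
  rw [pairing_eq_sum hK hf, pairing_eq_sum hK hg, pairing_eq_sum hK (hf.add hg),
    ← Finset.sum_add_distrib]
  refine Finset.sum_congr rfl fun j _ => ?_
  rw [← integral_add (integrableOn_localDensity hK f φ j) (integrableOn_localDensity hK g φ j)]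
  congr 1
  funext z
  have : topCoeff (𝔄.chart j) (f + g).val z =
    topCoeff (𝔄.chart j) f.val z + topCoeff (𝔄.chart j) g.val z := rfl
  simp only [localDensity, this]
  ring

theorem pairing_smul {K : Set M} (hK : IsCompact K) {f : SmoothForm 𝔄 m n}
    (hf : SupportedIn f K) (c : ℂ) (φ : SmoothFun n M m) :
    pairing (c • f) φ = c * pairing f φ := by
  rw [pairing_eq_sum hK hf, pairing_eq_sum hK (hf.smul c), Finset.mul_sum]
  refine Finset.sum_congr rfl fun j _ => ?_
  rw [← integral_const_mul]
  congr 1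
  funext z
  have : topCoeff (𝔄.chart j) (c • f).val z = c * topCoeff (𝔄.chart j) f.val z := rfl
  simp only [localDensity, this]
  ring

/-- For fixed `φ` the pairing is continuous on the forms supported in a compact set. -/
theorem exists_norm_pairing_le (𝔄 : OrientedAtlas n M) {K : Set M} (hK : IsCompact K)
    (φ : SmoothFun n M m) :
    ∃ C : ℝ, 0 ≤ C ∧ ∃ s, ∀ f : SmoothForm 𝔄 m n, SupportedIn f K →
      ‖pairing f φ‖ ≤ C * formSeminorm 𝔄 m n s f := by
  classical
  obtain ⟨B, hB⟩ := (hK.prod (isCompact_univ (X := Torus m))).exists_bound_of_continuousOn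
    φ.continuous.continuousOn
  let S : ℕ → Set (Euc n × Torus m) := fun j =>
    ((𝔄.chart j) '' (partitionCompact 𝔄 hK j).carrier) ×ˢ univ
  -- Order `0` suffices, on the compact pieces over which the pairing is integrated. Below, `max B
  -- 0` replaces `B`, which may be negative when `K` is empty.
  let s : Finset (ChartCompact 𝔄) × ℕ :=
    ((partitionIndices 𝔄 hK).image (partitionCompact 𝔄 hK), 0)
  refine ⟨∑ j ∈ partitionIndices 𝔄 hK, max B 0 * volume.real (S j),
    Finset.sum_nonneg fun j _ => by positivity, s, fun f hf => ?_⟩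
  rw [pairing_eq_sum hK hf, Finset.sum_mul]
  refine (norm_sum_le _ _).trans (Finset.sum_le_sum fun j hj => ?_)
  have h1 : ∀ z ∈ S j, ‖localDensity f φ j z‖ ≤ max B 0 * formSeminorm 𝔄 m n s f := by
    intro z hz
    have h2 : ‖topCoeff (𝔄.chart j) f.val z‖ ≤ formSeminorm 𝔄 m n s f :=
      (norm_topCoeff_le f (partitionCompact 𝔄 hK j) hz.1).trans
        (derivSeminorm_le_formSeminorm s (Finset.mem_image_of_mem _ hj) le_rfl f)
    have h3 : ‖φ.toFun ((𝔄.chart j).symm z.1, z.2)‖ ≤ max B 0 := by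
      obtain ⟨t, ht, hzt⟩ := hz.1
      refine (hB _ ⟨?_, mem_univ _⟩).trans (le_max_left _ _)
      have := (𝔄.chart j).left_inv ((partitionCompact 𝔄 hK j).subset ht)
      rw [← hzt, this]
      exact ht.1
    have h4 : ‖(𝔄.partition j ((𝔄.chart j).symm z.1) : ℂ)‖ ≤ 1 := by
      rw [Complex.norm_real, Real.norm_of_nonneg (𝔄.partition.nonneg j _)]
      exact 𝔄.partition.le_one j _
    rw [localDensity, norm_mul, norm_mul]
    calc _ ≤ 1 * (max B 0 * formSeminorm 𝔄 m n s f) := by gcongr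
      _ = _ := one_mul _
  calc _ ≤ (max B 0 * formSeminorm 𝔄 m n s f) * volume.real (S j) :=
        norm_setIntegral_le_of_norm_le_const
          (isCompact_partitionCompact_prod 𝔄 m hK j).measure_lt_top h1
    _ = _ := by ring

/-- The space of compatible forms with support in `K × 𝕋ᵐ`. -/
def compatibleSubmodule (w : Fin m → ClosedOneForm 𝔄) {K : Set M} (hK : IsCompact K) :
    Submodule ℂ (SmoothForm 𝔄 m n) where
  carrier := {f | SupportedIn f K ∧ Compatible w f}
  add_mem' := fun {f g} hf hg => ⟨hf.1.add hg.1, fun φ hφ => by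
    rw [pairing_add hK hf.1 hg.1, hf.2 φ hφ, hg.2 φ hφ, add_zero]⟩
  zero_mem' := by
    have h0 : SupportedIn (0 : SmoothForm 𝔄 m n) K := fun _ _ => rfl
    refine ⟨h0, fun φ _ => ?_⟩
    rw [← zero_smul ℂ (0 : SmoothForm 𝔄 m n), pairing_smul hK h0, zero_mul]
  smul_mem' := fun c f hf => ⟨hf.1.smul c, fun φ hφ => by
    rw [pairing_smul hK hf.1, hf.2 φ hφ, mul_zero]⟩

/-- The pairing with `φ`, as a linear functional on the compatible forms supported in `K × 𝕋ᵐ`. -/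
def pairingLinear (w : Fin m → ClosedOneForm 𝔄) {K : Set M} (hK : IsCompact K)
    (φ : SmoothFun n M m) : compatibleSubmodule w hK →ₗ[ℂ] ℂ where
  toFun f := pairing f.1 φ
  map_add' f g := pairing_add hK f.2.1 g.2.1 φ
  map_smul' c f := pairing_smul hK f.2.1 c φ

/-- For `φ` in the kernel of `L⁰`, the pairing with `g` equals that with `g - f r`, which tends to
`0` by continuity on forms supported in `K`. -/
theorem mem_compatibleSubmodule_of_tendsto (w : Fin m → ClosedOneForm 𝔄) {K : Set M}
    (hK : IsCompact K) {f : ℕ → SmoothForm 𝔄 m n} (hf : ∀ i, f i ∈ compatibleSubmodule w hK)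
    {g : SmoothForm 𝔄 m n} (hg : SupportedIn g K)
    (h : ∀ s, Tendsto (fun r => formSeminorm 𝔄 m n s (g - f r)) atTop (𝓝 0)) :
    g ∈ compatibleSubmodule w hK := by
  refine ⟨hg, fun φ hφ => ?_⟩
  obtain ⟨C, hC, s, hs⟩ := exists_norm_pairing_le 𝔄 hK φ
  have h1 : ∀ r, ‖pairing g φ‖ ≤ C * formSeminorm 𝔄 m n s (g - f r) := by
    intro r
    have hd : SupportedIn (g - f r) K := by
      rw [sub_eq_add_neg, ← neg_one_smul ℂ (f r)]
      exact hg.add ((hf r).1.smul _)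
    have h2 : pairing g φ = pairing (g - f r) φ := by
      conv_lhs => rw [← sub_add_cancel g (f r), pairing_add hK hd (hf r).1, (hf r).2 φ hφ, add_zero]
    rw [h2]
    exact hs _ hd
  have h3 := ge_of_tendsto' ((h s).const_mul C) h1
  rw [mul_zero] at h3
  exact norm_le_zero_iff.1 h3

end Pairing

end

end InvolutiveSystem

open scoped Manifold ContDiff in
open InvolutiveSystem in
theorem proposition5p2 {n : ℕ} (hn : 1 ≤ n) {M : Type*} [TopologicalSpace M]
    [ChartedSpace (EuclideanSpace ℝ (Fin n)) M] [IsManifold (𝓡 n) ∞ M] [T2Space M]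
    [SecondCountableTopology M] (𝔄 : OrientedAtlas n M) {m : ℕ} (w : Fin m → ClosedOneForm 𝔄)
    (hw : GloballySolvable w) (K : Set M) (hK : IsCompact K) :
    ∃ C : ℝ, 0 < C ∧
      ∃ k : Finset (ChartCompact 𝔄) × ℕ, ∃ l : Finset (ChartCompact 𝔄) × ℕ,
        ∀ f : SmoothForm 𝔄 m n, SupportedIn f K → Compatible w f → ∀ φ : SmoothFun n M m,
          ‖pairing f φ‖ ≤ C * formSeminorm 𝔄 m n k f * formSeminorm 𝔄 m 1 l (L0 w φ) := by
  obtain ⟨S, hS⟩ := exists_cofinal_formSeminorm 𝔄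
  have hle : ∀ {q : ℕ} s, ∃ C : ℝ, 0 ≤ C ∧ ∃ N, ∀ f : SmoothForm 𝔄 m q,
      formSeminorm 𝔄 m q s f ≤ C * formSeminorm 𝔄 m q (S N) f := fun {q} s => by
    obtain ⟨C, N, h⟩ := (hS m q).2 s
    exact ⟨C, C.2, N, fun f => h f⟩
  suffices hmain : ∃ C : ℝ, 0 < C ∧ ∃ N, ∀ (f : compatibleSubmodule w hK)
      (φ : SmoothFun n M m), ‖pairingLinear w hK φ f‖ ≤
        C * formSeminorm 𝔄 m n (S N) f.1 * formSeminorm 𝔄 m 1 (S N) (L0 w φ) by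
    obtain ⟨C, hC, N, h⟩ := hmain
    exact ⟨C, hC, S N, S N, fun f hf hf' φ => h ⟨f, hf, hf'⟩ φ⟩
  -- The three substantial goals left are completeness of the space of compatible forms, continuity
  -- in `f`, and control by the gauges of `L⁰φ`.
  refine Seminorm.exists_bilinear_bound
    (p := fun N => (formSeminorm 𝔄 m n (S N)).comp (compatibleSubmodule w hK).subtype)
    (fun a b hab f => (hS m n).1 hab f.1) (fun f hf => ?_) (pairingLinear w hK) (fun φ => ?_)
    (fun N φ => formSeminorm 𝔄 m 1 (S N) (L0 w φ)) (fun a b hab φ => (hS m 1).1 hab (L0 w φ))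
    (fun N φ => apply_nonneg _ _) (fun f => ?_)
  · have hsum : ∀ s, Summable fun i => formSeminorm 𝔄 m n s (f i).1 := fun s => by
      obtain ⟨C, -, N, h⟩ := hle (q := n) s
      exact ((hf N).mul_left C).of_nonneg_of_le (fun _ => apply_nonneg _ _) fun i => h (f i).1
    obtain ⟨g, hg, hlim⟩ := exists_tendsto_of_summable hsum
    -- The limit is the pointwise sum, so it vanishes wherever all the terms do.
    have hgK : SupportedIn g K := fun p hp => by
      rw [hg]
      have h0 : ∀ i, (f i).1.val p = 0 := fun i => (f i).2.1 p hp
      simp only [tsumForm, h0]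
      exact tsum_zero
    have hmem : g ∈ compatibleSubmodule w hK := mem_compatibleSubmodule_of_tendsto w hK
      (fun r => Submodule.sum_mem _ fun i _ => (f i).2) hgK hlim
    refine ⟨⟨g, hmem⟩, fun N => ?_⟩
    simpa using hlim (S N)
  · obtain ⟨C, hC, s, h⟩ := exists_norm_pairing_le 𝔄 hK φ
    obtain ⟨C', hC', N, h'⟩ := hle (q := n) s
    refine ⟨C * C', N, fun f => (h f.1 f.2.1).trans ?_⟩
    rw [mul_assoc]
    exact mul_le_mul_of_nonneg_left (h' f.1) hC
  -- Solvability enters only here: `u` depends on `f`, and its continuity gives a bound uniform in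
  -- `φ`. The sign `(-1)ⁿ` disappears in the norm.
  · obtain ⟨u, hu⟩ := hw f.1 ⟨K, hK, f.2.1⟩ f.2.2
    obtain ⟨s, C, -, h⟩ := Seminorm.bound_of_continuous (withSeminorms_formSeminorm 𝔄 m 1)
      ((normSeminorm ℂ ℂ).comp u.toLinearMap) u.continuous.norm
    -- Continuity of `u` yields a finite supremum of standard seminorms; cofinality absorbs it into
    -- one member of the sequence.
    have hs : ∃ C' : ℝ, 0 ≤ C' ∧ ∃ N, ∀ g : SmoothForm 𝔄 m 1,
        s.sup (formSeminorm 𝔄 m 1) g ≤ C' * formSeminorm 𝔄 m 1 (S N) g := by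
      choose c hc N hN using fun s => hle (q := 1) s
      refine ⟨∑ i ∈ s, c i, Finset.sum_nonneg fun i _ => hc i, s.sup N, fun g => ?_⟩
      refine (Seminorm.finset_sup_le_sum _ s g).trans ?_
      simp only [sum_apply]
      rw [Finset.sum_mul]
      refine Finset.sum_le_sum fun i hi => (hN i g).trans ?_
      exact mul_le_mul_of_nonneg_left ((hS m 1).1 (Finset.le_sup hi) g) (hc i)
    obtain ⟨C', hC', N, h'⟩ := hs
    refine ⟨C * C', N, fun φ => ?_⟩
    have h1 : ‖pairing f.1 φ‖ = ‖u (L0 w φ)‖ := by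
      rw [← hu φ, LTop, norm_mul, norm_pow, norm_neg, norm_one, one_pow, one_mul]
    refine h1.le.trans ((h (L0 w φ)).trans ?_)
    rw [mul_assoc]
    exact mul_le_mul_of_nonneg_left (h' (L0 w φ)) C.2
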